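/- Let $\mathcal X=[-1,1]^D$. For continuous $f:\mathbb R^D\to\mathbb R$ put $f^*=\min_{x\in\mathcal X}f(x)$. A function $f$ has effective dimension $d_e$ with effective subspace $\mathcal T\subseteq\mathbb R^D$ if $\mathcal T$ is a linear subspace of dimension $d_e$ with $f(x_\top+x_\perp)=f(x_\top)$ for all $x_\top\in\mathcal T$ and $x_\perp\in\mathcal T^\perp$, and no linear subspace of smaller dimension has this property. A $D\times d$ Gaussian matrix is a random matrix whose entries are independent standard normal variables. For $p\in\mathcal X$ and a $D\times d$ matrix $A$, the reduced problem (RP$\mathcal X$), $\min_{y\in\mathbb R^d} f(Ay+p)$ subject to $Ay+p\in\mathcal X$, is called successful if there is $y^*\in\mathbb R^d$ with $f(Ay^*+p)=f^*$ and $Ay^*+p\in\mathcal X$. **Theorem.** Fix integers $0\le d_e\le d$. There are numbers $\tau=\tau(D)=\tau(D,d_e,d)$ such that $$\tau(D)=\Theta\!\left(\frac{\bigl(\log(D-d_e+1)\bigr)^{\frac{d-1}{2}}}{2^{D-d_e}\,(D-d_e+1)^{d_e}}\right)\quad\text{as } D\to\infty,$$ where the constants in $\Theta(\cdot)$ depend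 only on $d_e$ and $d$, and such that the following holds for every $D>d_e$: if $f:\mathbb R^D\to\mathbb R$ is continuous and has effective dimension $d_e$ with an effective subspace $\mathcal T$ spanned by $d_e$ of the standard basis vectors of $\mathbb R^D$, and if $A$ is a $D\times d$ Gaussian matrix, then for all $p\in\mathcal X$ $$\mathbb P\bigl[\text{(RP}\mathcal X\text{) is successful}\bigr]\ \ge\ \tau(D)>0 .$$ -/

import Mathlib

open MeasureTheory ProbabilityTheory Filter Asymptotics
open scoped Matrix

/-- The box `𝒳 = [-1,1]^D`, as a subset of Euclidean space `ℝ^D`. -/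
def feasibleBox (D : ℕ) : Set (EuclideanSpace ℝ (Fin D)) :=
  {x | ∀ i, x i ∈ Set.Icc (-1 : ℝ) 1}

/-- The optimal value `f^* = min {f(x) : x ∈ 𝒳}`. For continuous `f` the infimum is attained,
since the box is compact and nonempty. -/
noncomputable def optimalValue {D : ℕ} (f : EuclideanSpace ℝ (Fin D) → ℝ) : ℝ :=
  sInf (f '' feasibleBox D)

/-- `f(x_⊤ + x_⊥) = f(x_⊤)` for all `x_⊤ ∈ T` and all `x_⊥` in the orthogonal complement of `T`. -/
def DependsOnlyOnProjection {D : ℕ} (f : EuclideanSpace ℝ (Fin D) → ℝ)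
    (T : Submodule ℝ (EuclideanSpace ℝ (Fin D))) : Prop :=
  ∀ x ∈ T, ∀ z ∈ Tᗮ, f (x + z) = f x

/-- `f` has effective dimension `k`, with effective subspace `T`: the subspace `T` has dimension
`k`, the function `f` depends only on the projection onto `T`, and no subspace of smaller
dimension has this property. -/
structure HasEffectiveSubspace {D : ℕ} (f : EuclideanSpace ℝ (Fin D) → ℝ) (k : ℕ)
    (T : Submodule ℝ (EuclideanSpace ℝ (Fin D))) : Prop where
  finrank_eq : Module.finrank ℝ T = k
  dependsOnly : DependsOnlyOnProjection f T
  minimal : ∀ T' : Submodule ℝ (EuclideanSpace ℝ (Fin D)),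
    DependsOnlyOnProjection f T' → k ≤ Module.finrank ℝ T'

/-- The coordinate subspace spanned by the standard basis vectors `e_i` with `i ∈ S`. -/
noncomputable def coordinateSubspace {D : ℕ} (S : Finset (Fin D)) :
    Submodule ℝ (EuclideanSpace ℝ (Fin D)) :=
  Submodule.span ℝ ((fun i => EuclideanSpace.single i (1 : ℝ)) '' (S : Set (Fin D)))

/-- A `D × d` Gaussian random matrix: its entries are independent standard normal variables. -/
structure IsGaussianMatrix {Ω : Type*} [MeasurableSpace Ω] (P : Measure Ω) {D d : ℕ}
    (A : Ω → Matrix (Fin D) (Fin d) ℝ) : Prop where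
  hasLaw : ∀ i j, HasLaw (fun ω => A ω i j) (gaussianReal 0 1) P
  indep : iIndepFun (fun (ij : Fin D × Fin d) (ω : Ω) => A ω ij.1 ij.2) P

/-- The reduced problem `min_y f(A y + p)` subject to `A y + p ∈ 𝒳` is successful: some
`y ∈ ℝ^d` satisfies `A y + p ∈ 𝒳` and `f(A y + p) = f^*`. -/
def ReducedProblemSuccessful {D d : ℕ} (f : EuclideanSpace ℝ (Fin D) → ℝ)
    (p : EuclideanSpace ℝ (Fin D)) (A : Matrix (Fin D) (Fin d) ℝ) : Prop :=
  ∃ y : Fin d → ℝ, f (WithLp.toLp 2 (A *ᵥ y) + p) = optimalValue f ∧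
    WithLp.toLp 2 (A *ᵥ y) + p ∈ feasibleBox D

/-!
Write `m` for the effective dimension, `n = D - m`, and `φ` for the standard normal density. Let `x`
be a minimiser of `f` on the box. Since `f` only depends on the `m` coordinates in `S`, the reduced
problem succeeds as soon as some `y` solves `⟪b i, y⟫ + p i = x i` for `i ∈ S`, where `b i` are the
rows of the matrix, and keeps the other `n` coordinates `⟪b i, y⟫ + p i` in `[-1, 1]`.

The rows are independent standard Gaussian vectors of `ℝ^d`. The first requirement is a linear
system with a right-hand side of norm at most `2 √m`. Rotating the right-hand side to a coordinate
vector and conditioning on all rows but one shows that it has a solution with `‖y‖ ≤ 2 / t` with at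
least the probability that a chi variable with `k = d - m + 1` degrees of freedom exceeds `√m t`
(`pi_stdGaussian_exists_ge`); this is at least of order `t ^ (k - 2) exp (-m t ^ 2 / 2)`
(`exists_le_stdGaussian_norm_ge`). Given such a `y`, each remaining coordinate lies in `[-1, 1]`
with probability at least `1 / 2 - φ(t) / t` (`le_stdGaussian_inner_add_mem_Icc`), independently of
the others. The two bounds multiply by Fubini's theorem (`le_pi_stdGaussian_feasibleHitSet`).

It remains to choose `t`. With `L = log (n + 1)` and `t ^ 2 = 2 L - log L` one has `t` of order `√L`
and `exp (-t ^ 2 / 2) = √L / (n + 1)`. Then `n φ(t) / t` is bounded, which leaves a constant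
multiple of `2 ^ (-n)` from the second factor, while the first is at least a constant multiple of
`√L ^ (k - 2) (√L / (n + 1)) ^ m = L ^ ((d - 1) / 2) / (n + 1) ^ m`. A constant multiple of the rate
is therefore an admissible `τ`. In effective dimension `0` the problem always succeeds.
-/

/-! ### The standard Gaussian measure: density, images, norm tail -/

theorem stdGaussian_eq_withDensity (E : Type*) [NormedAddCommGroup E] [InnerProductSpace ℝ E]
    [FiniteDimensional ℝ E] [MeasurableSpace E] [BorelSpace E] :
    stdGaussian E = (volume : Measure E).withDensity fun x =>
      ENNReal.ofReal ((2 * Real.pi) ^ (-(Module.finrank ℝ E : ℝ) / 2) *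
        Real.exp (-‖x‖ ^ 2 / 2)) := by
  set C : ℝ := (2 * Real.pi) ^ (-(Module.finrank ℝ E : ℝ) / 2) with hC
  have hCpos : 0 < C := by positivity
  have hint : Integrable (fun x : E => C * Real.exp (-‖x‖ ^ 2 / 2)) := by
    have h := (GaussianFourier.integrable_cexp_neg_mul_sq_norm_add (V := E) (b := 1 / 2)
      (by norm_num) 0 0).norm
    refine (h.const_mul C).congr (ae_of_all _ fun x => ?_)
    simp only [Complex.norm_exp]
    congr 2
    rw [inner_zero_left, Complex.ofReal_zero, mul_zero, add_zero,
      show -(1 / 2 : ℂ) * (‖x‖ : ℂ) ^ 2 = ((-‖x‖ ^ 2 / 2 : ℝ) : ℂ) by push_cast; ring,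
      Complex.ofReal_re]
  have hfin : IsFiniteMeasure ((volume : Measure E).withDensity fun x =>
      ENNReal.ofReal (C * Real.exp (-‖x‖ ^ 2 / 2))) :=
    isFiniteMeasure_withDensity_ofReal hint.2
  apply Measure.ext_of_charFun
  ext t
  rw [charFun_stdGaussian, charFun_apply,
    integral_withDensity_eq_integral_toReal_smul (by fun_prop) (by simp)]
  have h := GaussianFourier.integral_cexp_neg_mul_sq_norm_add (V := E) (b := 1 / 2)
      (by norm_num) Complex.I t
  have hfun : ∀ x : E, (ENNReal.ofReal (C * Real.exp (-‖x‖ ^ 2 / 2))).toReal •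
      Complex.exp ((inner ℝ x t : ℝ) * Complex.I) =
      (C : ℂ) * Complex.exp (-(1 / 2) * ‖x‖ ^ 2 + Complex.I * (inner ℝ t x : ℝ)) := by
    intro x
    rw [ENNReal.toReal_ofReal (by positivity), Complex.real_smul, Complex.ofReal_mul, mul_assoc,
      Complex.ofReal_exp, ← Complex.exp_add, real_inner_comm]
    congr 2
    push_cast
    ring
  simp_rw [hfun]
  rw [integral_const_mul, h, hC, Complex.ofReal_cpow (by positivity), ← mul_assoc]
  have h2 : ((2 * Real.pi : ℝ) : ℂ) ^ (((-(Module.finrank ℝ E : ℝ) / 2 : ℝ)) : ℂ) *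
      ((Real.pi : ℂ) / (1 / 2)) ^ ((Module.finrank ℝ E : ℂ) / 2) = 1 := by
    have : (Real.pi : ℂ) / (1 / 2) = ((2 * Real.pi : ℝ) : ℂ) := by push_cast; ring
    rw [this, ← Complex.cpow_add _ _ (by norm_cast; positivity)]
    push_cast
    ring_nf
    simp
  rw [h2, one_mul]
  congr 1
  simp
  ring

/-- The coordinates of a standard Gaussian vector with respect to an orthonormal family, here the
image of an isometry `L`, form a standard Gaussian vector. -/
theorem stdGaussian_map_adjoint {E F : Type*} [NormedAddCommGroup E] [InnerProductSpace ℝ E]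
    [FiniteDimensional ℝ E] [MeasurableSpace E] [BorelSpace E]
    [NormedAddCommGroup F] [InnerProductSpace ℝ F]
    [FiniteDimensional ℝ F] [MeasurableSpace F] [BorelSpace F] (L : F →ₗᵢ[ℝ] E) :
    (stdGaussian E).map (ContinuousLinearMap.adjoint L.toContinuousLinearMap) = stdGaussian F := by
  apply Measure.ext_of_charFun
  ext t
  have h := charFun_stdGaussian (L t)
  rw [charFun_apply] at h
  rw [charFun_apply, integral_map (by fun_prop) (by fun_prop), charFun_stdGaussian,
    ← L.norm_map t, ← h]
  simp [ContinuousLinearMap.adjoint_inner_left]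

theorem stdGaussian_map_inner {E : Type*} [NormedAddCommGroup E] [InnerProductSpace ℝ E]
    [FiniteDimensional ℝ E] [MeasurableSpace E] [BorelSpace E] (y : E) :
    (stdGaussian E).map (fun x => inner ℝ x y) = (gaussianReal 0 1).map (fun u => ‖y‖ * u) := by
  apply Measure.ext_of_charFun
  ext t
  have h := charFun_stdGaussian (t • y)
  rw [charFun_apply] at h
  rw [charFun_map_mul, charFun_gaussianReal, charFun_apply,
    integral_map (by fun_prop) (by fun_prop)]
  simp only [inner_smul_right] at h
  simp only [RCLike.inner_apply, conj_trivial]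
  rw [h]
  congr 1
  simp [norm_smul, ← Complex.ofReal_pow, mul_pow]
  ring

/-- A lower bound of the right order for the tail of the chi distribution with `k` degrees of
freedom. It comes from the shell `x ≤ ‖v‖ < x + 1 / x`, on which the density is within a constant
factor of its value at radius `x`, and whose volume is at least that of the unit ball times
`x ^ (k - 2)`. -/
theorem exists_le_stdGaussian_norm_ge (k : ℕ) (hk : 1 ≤ k) :
    ∃ c : ℝ, 0 < c ∧ ∀ x : ℝ, 1 ≤ x →
      ENNReal.ofReal (c * (x ^ ((k : ℝ) - 2) * Real.exp (-x ^ 2 / 2))) ≤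
        stdGaussian (EuclideanSpace ℝ (Fin k)) {v | x ≤ ‖v‖} := by
  set F := EuclideanSpace ℝ (Fin k)
  set ω : ℝ := (volume : Measure F).real (Metric.ball 0 1) with hω
  have : Nonempty (Fin k) := ⟨⟨0, hk⟩⟩
  have hωpos : 0 < ω :=
    ENNReal.toReal_pos (Metric.measure_ball_pos _ _ one_pos).ne' measure_ball_lt_top.ne
  set C : ℝ := (2 * Real.pi) ^ (-(Module.finrank ℝ F : ℝ) / 2) with hC
  have hCpos : 0 < C := by positivity
  refine ⟨C * Real.exp (-(3 / 2)) * ω, by positivity, fun x hx => ?_⟩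
  have hx0 : 0 < x := by linarith
  have hvol : ∀ r : ℝ, 0 ≤ r →
      (volume : Measure F) (Metric.ball 0 r) = ENNReal.ofReal (r ^ k * ω) := by
    intro r hr
    rw [Measure.addHaar_ball _ _ hr, hω, ENNReal.ofReal_mul (by positivity),
      ofReal_measureReal (by finiteness)]
    simp [F]
  have hpow : x ^ ((k : ℝ) - 2) ≤ (x + 1 / x) ^ k - x ^ k := by
    have h1 : x + 1 / x = x * (1 + 1 / x ^ 2) := by field_simp
    have h2 : 1 + (k : ℝ) * (1 / x ^ 2) ≤ (1 + 1 / x ^ 2) ^ k :=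
      one_add_mul_le_pow (by have : 0 < 1 / x ^ 2 := by positivity
                             linarith) k
    have h3 : (1 : ℝ) ≤ k := by exact_mod_cast hk
    rw [h1, mul_pow, Real.rpow_sub hx0, Real.rpow_natCast, Real.rpow_ofNat]
    have h4 : 1 / x ^ 2 ≤ (k : ℝ) * (1 / x ^ 2) := le_mul_of_one_le_left (by positivity) h3
    have h5 : x ^ k * (1 + 1 / x ^ 2) ≤ x ^ k * (1 + 1 / x ^ 2) ^ k := by gcongr; linarith
    have h6 : x ^ k / x ^ 2 = x ^ k * (1 + 1 / x ^ 2) - x ^ k := by ring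
    linarith
  -- The shell `U`; its volume is bounded below by `hpow`, Bernoulli's inequality.
  set U : Set F := Metric.ball 0 (x + 1 / x) \ Metric.ball 0 x with hU
  have hUm : MeasurableSet U := measurableSet_ball.diff measurableSet_ball
  have hUvol : ENNReal.ofReal (x ^ ((k : ℝ) - 2) * ω) ≤ volume U := by
    rw [hU, measure_sdiff (Metric.ball_subset_ball (by simp [hx0.le]))
      measurableSet_ball.nullMeasurableSet
      measure_ball_lt_top.ne, hvol _ (by positivity), hvol _ hx0.le,
      ← ENNReal.ofReal_sub _ (by positivity)]
    apply ENNReal.ofReal_le_ofReal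
    rw [← sub_mul]
    gcongr
  calc ENNReal.ofReal (C * Real.exp (-(3 / 2)) * ω * (x ^ ((k : ℝ) - 2) * Real.exp (-x ^ 2 / 2)))
      = ENNReal.ofReal (C * (Real.exp (-(3 / 2)) * Real.exp (-x ^ 2 / 2))) *
          ENNReal.ofReal (x ^ ((k : ℝ) - 2) * ω) := by
        rw [← ENNReal.ofReal_mul (by positivity)]; congr 1; ring
    _ ≤ ENNReal.ofReal (C * (Real.exp (-(3 / 2)) * Real.exp (-x ^ 2 / 2))) * volume U := by gcongr
    _ = ∫⁻ _ in U, ENNReal.ofReal (C * (Real.exp (-(3 / 2)) * Real.exp (-x ^ 2 / 2))) := by simp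
    _ ≤ ∫⁻ v in U, ENNReal.ofReal (C * Real.exp (-‖v‖ ^ 2 / 2)) := by
        refine setLIntegral_mono (by fun_prop) fun v hv => ENNReal.ofReal_le_ofReal ?_
        rw [← Real.exp_add]
        gcongr
        have hv1 : ‖v‖ < x + 1 / x := by simpa using hv.1
        have h1 : ‖v‖ ^ 2 ≤ (x + 1 / x) ^ 2 := by gcongr
        have h2 : (x + 1 / x) ^ 2 = x ^ 2 + 2 + (1 / x) ^ 2 := by field_simp; ring
        have h3 : (1 / x) ^ 2 ≤ 1 := by
          apply pow_le_one₀ (by positivity)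
          rw [div_le_one hx0]; exact hx
        linarith
    _ = stdGaussian F U := by rw [stdGaussian_eq_withDensity, withDensity_apply _ hUm]
    _ ≤ _ := by
        refine measure_mono fun v hv => ?_
        exact not_lt.mp fun h => hv.2 (by simpa using h)

/-! ### Short solutions of Gaussian linear systems -/

/-- A Fubini bound in which the set `E` of good first coordinates need not be measurable. -/
theorem prod_ge_of_forall_fiber {α β : Type*} [MeasurableSpace α] [MeasurableSpace β]
    (μ : Measure α) (ν : Measure β) [SFinite ν] {G : Set (α × β)} (hG : MeasurableSet G)
    (E : Set α) (q : ENNReal) (h : ∀ x ∈ E, q ≤ ν (Prod.mk x ⁻¹' G)) :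
    q * μ E ≤ μ.prod ν G := by
  rw [Measure.prod_apply hG]
  calc q * μ E ≤ q * μ {x | q ≤ ν (Prod.mk x ⁻¹' G)} := by gcongr; exact h
    _ ≤ _ := mul_meas_ge_le_lintegral (measurable_measure_prodMk_left hG) q

/-- Searching for `y` in a compact set only makes the resulting events closed, hence measurable,
without any measurable selection. -/
theorem isClosed_setOf_exists_mem_of_isCompact {X Y : Type*} [TopologicalSpace X]
    [TopologicalSpace Y] {K : Set Y} (hK : IsCompact K) {Q : X → Y → Prop}
    (hQ : IsClosed {xy : X × Y | Q xy.1 xy.2}) : IsClosed {x | ∃ y ∈ K, Q x y} := by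
  have : CompactSpace K := isCompact_iff_compactSpace.mp hK
  have h : IsClosed {xy : X × K | Q xy.1 xy.2} :=
    hQ.preimage (f := fun xy : X × K => (xy.1, (xy.2 : Y))) (by fun_prop)
  convert isClosedMap_fst_of_compactSpace _ h using 1
  ext x
  simp

/-- If `k` dimensions are left over, `ℝ^k` embeds isometrically into the orthogonal complement of
the vectors `b j`. -/
theorem exists_linearIsometry_orthogonal {κ E : Type*} [Fintype κ]
    [NormedAddCommGroup E] [InnerProductSpace ℝ E] [FiniteDimensional ℝ E] (b : κ → E) (k : ℕ)
    (hk : k + Fintype.card κ ≤ Module.finrank ℝ E) :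
    ∃ L : EuclideanSpace ℝ (Fin k) →ₗᵢ[ℝ] E, ∀ v j, inner ℝ (b j) (L v) = 0 := by
  set U := Submodule.span ℝ (Set.range b)
  have h1 : Module.finrank ℝ U ≤ Fintype.card κ := finrank_range_le_card b
  have h2 := U.finrank_add_finrank_orthogonal
  have h3 : k ≤ Module.finrank ℝ Uᗮ := by omega
  obtain ⟨v, hv⟩ := exists_linearIndependent_of_le_finrank h3
  set W := Submodule.span ℝ (Set.range v)
  have hW : Module.finrank ℝ W = k := by simpa using finrank_span_eq_card hv
  set o := (stdOrthonormalBasis ℝ W).reindex (finCongr hW)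
  refine ⟨Uᗮ.subtypeₗᵢ.comp (W.subtypeₗᵢ.comp o.repr.symm.toLinearIsometry), fun x j => ?_⟩
  exact Submodule.inner_right_of_mem_orthogonal (Submodule.subset_span (Set.mem_range_self j))
    (SetLike.coe_mem (p := Uᗮ) _)

section Rows

variable {ι : Type*} [Fintype ι] {E : Type*} [NormedAddCommGroup E] [InnerProductSpace ℝ E]
    [FiniteDimensional ℝ E] [MeasurableSpace E] [BorelSpace E]

theorem charFun_pi_stdGaussian (t : PiLp 2 fun _ : ι => E) :
    charFun ((Measure.pi fun _ : ι => stdGaussian E).map (WithLp.toLp 2)) t =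
      Complex.exp (((-(∑ i, ‖t i‖ ^ 2) / 2 : ℝ) : ℂ)) := by
  rw [charFun_pi]
  simp only [charFun_stdGaussian]
  rw [← Complex.exp_sum]
  congr 1
  push_cast
  rw [← Finset.sum_div, Finset.sum_neg_distrib]

/-- Mixing independent standard Gaussian rows `b i` by an orthogonal matrix preserves their joint
law. -/
theorem pi_stdGaussian_map_orthogonal [DecidableEq ι] {O : Matrix ι ι ℝ}
    (hO : O ∈ Matrix.orthogonalGroup ι ℝ) :
    (Measure.pi fun _ : ι => stdGaussian E).map (fun b i => ∑ j, O i j • b j) =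
      Measure.pi fun _ : ι => stdGaussian E := by
  have hmeas : Measurable fun (b : ι → E) (i : ι) => ∑ j, O i j • b j := by fun_prop
  have : IsProbabilityMeasure
      ((Measure.pi fun _ : ι => stdGaussian E).map (fun b i => ∑ j, O i j • b j)) :=
    Measure.isProbabilityMeasure_map hmeas.aemeasurable
  rw [← charFun_eq_pi_iff]
  intro t
  -- Moving `O` to the other side of the inner product turns `t` into `Oᵀ t`, of the same norm.
  have key : charFun ((Measure.pi fun _ : ι => stdGaussian E).map (WithLp.toLp 2))
      (WithLp.toLp 2 fun j => ∑ i, O i j • t i) = ∏ i, charFun (stdGaussian E) (t i) := by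
    rw [← charFun_pi, charFun_pi_stdGaussian, charFun_pi_stdGaussian]
    congr 4
    have h1 : O * Oᵀ = 1 := (Matrix.mem_orthogonalGroup_iff ι ℝ).mp hO
    have h2 : ∀ i i', ∑ j, O i j * O i' j = if i = i' then 1 else 0 := fun i i' => by
      have := congrFun (congrFun h1 i) i'
      simpa [Matrix.mul_apply, Matrix.one_apply] using this
    simp only [← real_inner_self_eq_norm_sq, sum_inner, inner_sum, real_inner_smul_left,
      real_inner_smul_right]
    rw [Finset.sum_comm]
    refine Finset.sum_congr rfl fun i _ => ?_
    rw [Finset.sum_comm]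
    calc _ = ∑ i', (∑ j, O i j * O i' j) * inner ℝ (t i) (t i') := by
          refine Finset.sum_congr rfl fun i' _ => ?_
          rw [Finset.sum_mul]
          refine Finset.sum_congr rfl fun j _ => ?_
          ring_nf
          rw [real_inner_comm]
      _ = _ := by simp [h2]
  have htoLp : Measurable (WithLp.toLp 2 : (ι → E) → PiLp 2 fun _ : ι => E) :=
    (MeasurableEquiv.toLp 2 (ι → E)).measurable
  rw [← key, Measure.map_map htoLp hmeas, charFun_apply, charFun_apply,
    integral_map (htoLp.comp hmeas).aemeasurable (by fun_prop),
    integral_map htoLp.aemeasurable (by fun_prop)]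
  refine integral_congr_ae (ae_of_all _ fun b => ?_)
  simp only [Function.comp_apply, PiLp.inner_apply, sum_inner, inner_sum, real_inner_smul_left,
      real_inner_smul_right]
  rw [Finset.sum_comm]

/-- A reflection carries `z` to the multiple `‖z‖` of a coordinate vector. -/
theorem exists_orthogonal_mulVec_eq_single [DecidableEq ι] (z : EuclideanSpace ℝ ι) (i₀ : ι) :
    ∃ O ∈ Matrix.orthogonalGroup ι ℝ, O *ᵥ (z : ι → ℝ) = Pi.single i₀ ‖z‖ := by
  set w : EuclideanSpace ℝ ι := EuclideanSpace.single i₀ ‖z‖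
  set R := (ℝ ∙ (z - w))ᗮ.reflection
  have hR : R z = w := Submodule.reflection_sub (by simp [w])
  set a := EuclideanSpace.basisFun ι ℝ
  refine ⟨a.toBasis.toMatrix (a.map R), ?_, ?_⟩
  · exact a.toMatrix_orthonormalBasis_mem_unitary (a.map R)
  · ext i
    have h : z = ∑ j, z j • a j := by
      exact (a.sum_repr z).symm.trans (by simp [a])
    have h2 := congrArg (fun v : EuclideanSpace ℝ ι => v i) hR
    simp only at h2
    rw [h, map_sum] at h2
    simp [w] at h2
    simp [Matrix.mulVec, dotProduct, Module.Basis.toMatrix_apply, Pi.single_apply]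
    rw [← h2]
    refine Finset.sum_congr rfl fun j _ => ?_
    simp [a, mul_comm]

theorem measurableSet_setOf_exists_inner_eq (z : ι → ℝ) (ρ : ℝ) :
    MeasurableSet {b : ι → E | ∃ y ∈ Metric.closedBall (0 : E) ρ, ∀ i, inner ℝ (b i) y = z i} := by
  refine (isClosed_setOf_exists_mem_of_isCompact (isCompact_closedBall _ _) ?_).measurableSet
  simp only [Set.ofPred_forall]
  exact isClosed_iInter fun i => isClosed_eq (by fun_prop) (by fun_prop)

/-- The system `⟪b i₀, y⟫ = s`, `⟪b i, y⟫ = 0` for `i ≠ i₀`, has a solution of norm at most `ρ` with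
at least the probability that a standard Gaussian vector of `ℝ^k` has norm at least `s / ρ`. Given
the rows `i ≠ i₀`, put `ℝ^k` isometrically by `L` into their orthogonal complement: with
`v = Lᵀ (b i₀)` the vector `(s / ‖v‖ ^ 2) • L v` solves the system and has norm `s / ‖v‖`. -/
theorem pi_stdGaussian_exists_single_ge [DecidableEq ι] (i₀ : ι) (k : ℕ)
    (hk : k + Fintype.card ι ≤ Module.finrank ℝ E + 1) {s ρ : ℝ} (hs : 0 ≤ s) (hρ : 0 < ρ) :
    stdGaussian (EuclideanSpace ℝ (Fin k)) {v | s / ρ ≤ ‖v‖} ≤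
      (Measure.pi fun _ : ι => stdGaussian E)
        {b | ∃ y ∈ Metric.closedBall (0 : E) ρ,
          ∀ i, inner ℝ (b i) y = (Pi.single i₀ s : ι → ℝ) i} := by
  set G : Set (ι → E) :=
    {b | ∃ y ∈ Metric.closedBall (0 : E) ρ, ∀ i, inner ℝ (b i) y = (Pi.single i₀ s : ι → ℝ) i}
  have hG : MeasurableSet G := measurableSet_setOf_exists_inner_eq _ _
  have hmp := measurePreserving_piEquivPiSubtypeProd (fun _ : ι => stdGaussian E) (· ≠ i₀)
  set e := MeasurableEquiv.piEquivPiSubtypeProd (fun _ : ι => E) (· ≠ i₀)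
  rw [← hmp.symm.measure_preimage hG.nullMeasurableSet]
  set V : Set (EuclideanSpace ℝ (Fin k)) := {v | s / ρ ≤ ‖v‖}
  refine le_trans ?_ (prod_ge_of_forall_fiber _ _ (e.symm.measurable hG) Set.univ
    (stdGaussian (EuclideanSpace ℝ (Fin k)) V) fun b _ => ?_)
  · rw [measure_univ, mul_one]
  obtain ⟨L, hL⟩ := exists_linearIsometry_orthogonal b k (by
    have : Fintype.card {i // i ≠ i₀} = Fintype.card ι - 1 := by simp
    have : 0 < Fintype.card ι := Fintype.card_pos_iff.mpr ⟨i₀⟩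
    omega)
  have hev := measurePreserving_eval (fun _ : {i // ¬ i ≠ i₀} => stdGaussian E) ⟨i₀, by simp⟩
  have hV : MeasurableSet V := measurableSet_le measurable_const measurable_norm
  have hadj : Measurable (ContinuousLinearMap.adjoint L.toContinuousLinearMap) := by fun_prop
  have hlaw := Measure.map_map hadj hev.measurable
    (μ := Measure.pi fun _ : {i // ¬ i ≠ i₀} => stdGaussian E)
  rw [hev.map_eq, stdGaussian_map_adjoint L] at hlaw
  rw [hlaw, Measure.map_apply (hadj.comp hev.measurable) hV]
  refine measure_mono fun c hc => ?_
  set g : E := c ⟨i₀, by simp⟩ with hg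
  set v := ContinuousLinearMap.adjoint L.toContinuousLinearMap g with hv
  have hvn : s / ρ ≤ ‖v‖ := hc
  -- For `s = 0` the vector `v` may vanish; then `y = 0` is a solution.
  rcases eq_or_lt_of_le hs with rfl | hs'
  · exact ⟨0, by simp [hρ.le], fun i => by simp⟩
  have hv0 : 0 < ‖v‖ := lt_of_lt_of_le (by positivity) hvn
  refine ⟨(s / ‖v‖ ^ 2) • L v, ?_, fun i => ?_⟩
  · rw [mem_closedBall_zero_iff, norm_smul, L.norm_map, Real.norm_of_nonneg (by positivity)]
    rw [div_le_iff₀ hρ] at hvn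
    have : s / ‖v‖ ^ 2 * ‖v‖ = s / ‖v‖ := by field_simp
    rw [this, div_le_iff₀ hv0]
    linarith
  · by_cases hi : i = i₀
    · subst hi
      have h1 : e.symm (b, c) i = g := by
        simp [e, MeasurableEquiv.piEquivPiSubtypeProd, hg]
      rw [h1, inner_smul_right, Pi.single_eq_same]
      have h2 : inner ℝ g (L v) = ‖v‖ ^ 2 := by
        rw [← real_inner_self_eq_norm_sq, ← L.coe_toContinuousLinearMap,
          ← ContinuousLinearMap.adjoint_inner_left]
      rw [h2]
      field_simp
    · have h1 : e.symm (b, c) i = b ⟨i, hi⟩ := by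
        simp [e, MeasurableEquiv.piEquivPiSubtypeProd, hi]
      rw [h1, inner_smul_right, hL, mul_zero, Pi.single_eq_of_ne hi]

/-- By rotation invariance the special right-hand side `s e_{i₀}` covers every right-hand side `z`
of norm `s`. -/
theorem pi_stdGaussian_exists_ge [Nonempty ι] (k : ℕ)
    (hk : k + Fintype.card ι ≤ Module.finrank ℝ E + 1) (z : EuclideanSpace ℝ ι)
    {ρ : ℝ} (hρ : 0 < ρ) :
    stdGaussian (EuclideanSpace ℝ (Fin k)) {v | ‖z‖ / ρ ≤ ‖v‖} ≤
      (Measure.pi fun _ : ι => stdGaussian E)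
        {b | ∃ y ∈ Metric.closedBall (0 : E) ρ, ∀ i, inner ℝ (b i) y = z i} := by
  classical
  obtain ⟨i₀⟩ := ‹Nonempty ι›
  obtain ⟨O, hO, hOz⟩ := exists_orthogonal_mulVec_eq_single z i₀
  refine (pi_stdGaussian_exists_single_ge (E := E) i₀ k hk (norm_nonneg z) hρ).trans ?_
  have hT : Measurable fun (b : ι → E) (i : ι) => ∑ j, O i j • b j := by fun_prop
  rw [← pi_stdGaussian_map_orthogonal hO,
    Measure.map_apply hT (measurableSet_setOf_exists_inner_eq _ _),
    pi_stdGaussian_map_orthogonal hO]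
  refine measure_mono fun b => ?_
  rintro ⟨y, hy, h⟩
  refine ⟨y, hy, fun i => ?_⟩
  have h1 : O *ᵥ (fun j => inner ℝ (b j) y) = O *ᵥ (z : ι → ℝ) := by
    rw [hOz]
    ext i
    rw [← h i]
    simp [Matrix.mulVec, dotProduct, sum_inner, real_inner_smul_left]
  have h2 : Oᵀ * O = 1 := (Matrix.mem_orthogonalGroup_iff' ι ℝ).mp hO
  have h3 := congrArg (fun w => Oᵀ *ᵥ w) h1
  simp only [Matrix.mulVec_mulVec, h2, Matrix.one_mulVec] at h3
  exact congrFun h3 i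

end Rows

/-! ### Gaussian measure of intervals -/

theorem gaussianPDFReal_zero_one :
    gaussianPDFReal 0 1 = fun u => (√(2 * Real.pi))⁻¹ * Real.exp (-u ^ 2 / 2) := by
  ext u
  simp [gaussianPDFReal]

theorem integral_Ioi_zero_gaussianPDFReal :
    ∫ u in Set.Ioi (0 : ℝ), gaussianPDFReal 0 1 u = 1 / 2 := by
  have h := integral_gaussian_Ioi (1 / 2)
  have h1 : ∀ x : ℝ, -x ^ 2 / 2 = -(1 / 2) * x ^ 2 := fun x => by ring
  simp only [gaussianPDFReal_zero_one, h1]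
  rw [integral_const_mul, h, show Real.pi / (1 / 2) = 2 * Real.pi by ring]
  have : √(2 * Real.pi) ≠ 0 := by positivity
  field_simp

/-- The Mills ratio bound `∫_t^∞ φ ≤ φ(t) / t`, from `t φ(u) ≤ u φ(u) = -φ'(u)`. -/
theorem integral_Ioi_gaussianPDFReal_le {t : ℝ} (ht : 0 < t) :
    ∫ u in Set.Ioi t, gaussianPDFReal 0 1 u ≤ gaussianPDFReal 0 1 t / t := by
  have hderiv : ∀ x ∈ Set.Ici t,
      HasDerivAt (fun u => -gaussianPDFReal 0 1 u) (x * gaussianPDFReal 0 1 x) x := by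
    intro x _
    have h1 : HasDerivAt (fun u : ℝ => -u ^ 2 / 2) (-x) x := by
      have h0 : HasDerivAt (fun u : ℝ => -u ^ 2 / 2) _ x := (hasDerivAt_pow 2 x).neg.div_const 2
      exact h0.congr_deriv (by ring)
    simp only [gaussianPDFReal_zero_one]
    have h2 : HasDerivAt (fun u : ℝ => -((√(2 * Real.pi))⁻¹ * Real.exp (-u ^ 2 / 2))) _ x :=
      (h1.exp.const_mul (√(2 * Real.pi))⁻¹).neg
    exact h2.congr_deriv (by ring)
  have hlim : Tendsto (fun u => -gaussianPDFReal 0 1 u) atTop (nhds 0) := by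
    simp only [gaussianPDFReal_zero_one]
    rw [← neg_zero, ← mul_zero (√(2 * Real.pi))⁻¹]
    refine (Tendsto.const_mul _ (Real.tendsto_exp_atBot.comp ?_)).neg
    simp only [neg_div]
    exact tendsto_neg_atTop_atBot.comp
      ((tendsto_pow_atTop two_ne_zero).atTop_div_const two_pos)
  have hpos : ∀ x ∈ Set.Ioi t, 0 ≤ x * gaussianPDFReal 0 1 x := fun x hx =>
    mul_nonneg (ht.le.trans (le_of_lt hx)) (gaussianPDFReal_nonneg _ _ _)
  have hint := integrableOn_Ioi_deriv_of_nonneg' hderiv hpos hlim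
  have hval := integral_Ioi_of_hasDerivAt_of_nonneg' hderiv hpos hlim
  rw [le_div_iff₀ ht, ← integral_mul_const]
  calc ∫ u in Set.Ioi t, gaussianPDFReal 0 1 u * t
      ≤ ∫ u in Set.Ioi t, u * gaussianPDFReal 0 1 u := by
        refine setIntegral_mono_on ((integrable_gaussianPDFReal 0 1).integrableOn.mul_const t) hint
          measurableSet_Ioi fun x hx => ?_
        rw [mul_comm]
        exact mul_le_mul_of_nonneg_right (le_of_lt hx) (gaussianPDFReal_nonneg _ _ _)
    _ = gaussianPDFReal 0 1 t := by rw [hval]; ring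

theorem gaussianPDFReal_le_of_le {a b : ℝ} (ha : 0 ≤ a) (hab : a ≤ b) :
    gaussianPDFReal 0 1 b ≤ gaussianPDFReal 0 1 a := by
  simp only [gaussianPDFReal_zero_one]
  gcongr

theorem gaussianPDFReal_zero_neg (a : ℝ) : gaussianPDFReal 0 1 (-a) = gaussianPDFReal 0 1 a := by
  simp [gaussianPDFReal]

/-- An interval of length `t` that contains `0` has the least Gaussian measure when `0` is an end
point, and then its measure is `1 / 2` minus the tail beyond `t`. -/
theorem le_gaussianReal_Icc {α β : ℝ} (hα : 0 ≤ α) (hβ : 0 ≤ β) (h : 0 < α + β) :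
    ENNReal.ofReal (1 / 2 - gaussianPDFReal 0 1 (α + β) / (α + β)) ≤
      gaussianReal 0 1 (Set.Icc (-α) β) := by
  set φ := gaussianPDFReal 0 1
  have hii : ∀ a b : ℝ, IntervalIntegrable φ volume a b := fun a b =>
    (integrable_gaussianPDFReal 0 1).intervalIntegrable
  rw [gaussianReal_apply_eq_integral 0 one_ne_zero]
  apply ENNReal.ofReal_le_ofReal
  rw [integral_Icc_eq_integral_Ioc, ← intervalIntegral.integral_of_le (by linarith),
    ← intervalIntegral.integral_add_adjacent_intervals (hii (-α) 0) (hii 0 β)]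
  have h1 : ∫ u in (-α)..0, φ u = ∫ u in (0)..α, φ u := by
    have := intervalIntegral.integral_comp_neg (a := 0) (b := α) φ
    rw [neg_zero] at this
    rw [← this]
    exact intervalIntegral.integral_congr fun x _ => gaussianPDFReal_zero_neg x
  -- The density decreases on the half-line, so shifting `[0, α]` to `[β, α + β]` loses mass.
  have h2 : ∫ u in (β)..(α + β), φ u ≤ ∫ u in (0)..α, φ u := by
    have := intervalIntegral.integral_comp_add_right (a := 0) (b := α) φ β
    rw [zero_add] at this
    rw [← this]
    refine intervalIntegral.integral_mono_on hα ?_ (hii _ _) fun x hx => ?_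
    · exact ((integrable_gaussianPDFReal 0 1).comp_add_right β).intervalIntegrable
    · exact gaussianPDFReal_le_of_le hx.1 (by linarith)
  have h3 := intervalIntegral.integral_add_adjacent_intervals (hii 0 β) (hii β (α + β))
  have h4 : ∫ u in (0)..(α + β), φ u = 1 / 2 - ∫ u in Set.Ioi (α + β), φ u := by
    rw [← integral_Ioi_zero_gaussianPDFReal, intervalIntegral.integral_Ioi_sub_Ioi]
    · exact (integrable_gaussianPDFReal 0 1).integrableOn
    · exact h.le
  have h5 := integral_Ioi_gaussianPDFReal_le h
  linarith

/-- If `‖y‖ ≤ 2 / t`, a coordinate of the random point stays feasible with probability at least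
`1 / 2 - φ(t) / t`, wherever in `[-1, 1]` its starting value `a` lies. -/
theorem le_stdGaussian_inner_add_mem_Icc {E : Type*} [NormedAddCommGroup E] [InnerProductSpace ℝ E]
    [FiniteDimensional ℝ E] [MeasurableSpace E] [BorelSpace E] {y : E} {t a : ℝ} (ht : 0 < t)
    (hy : ‖y‖ ≤ 2 / t) (ha : a ∈ Set.Icc (-1 : ℝ) 1) :
    ENNReal.ofReal (1 / 2 - gaussianPDFReal 0 1 t / t) ≤
      stdGaussian E {x | inner ℝ x y + a ∈ Set.Icc (-1 : ℝ) 1} := by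
  have hset : {x : E | inner ℝ x y + a ∈ Set.Icc (-1 : ℝ) 1} =
      (fun x => inner ℝ x y) ⁻¹' (Set.Icc (-1 - a) (1 - a)) := by
    ext x
    simp only [Set.mem_ofPred_eq, Set.mem_Icc, Set.mem_preimage]
    constructor <;> rintro ⟨_, _⟩ <;> constructor <;> linarith
  have hsum : (1 + a) * t / 2 + (1 - a) * t / 2 = t := by ring
  have h := le_gaussianReal_Icc (α := (1 + a) * t / 2) (β := (1 - a) * t / 2)
    (by have := ha.1; have : 0 ≤ 1 + a := by linarith
        positivity)
    (by have := ha.2; have : 0 ≤ 1 - a := by linarith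
        positivity) (by linarith)
  rw [hsum] at h
  rw [hset, ← Measure.map_apply (by fun_prop) measurableSet_Icc, stdGaussian_map_inner,
    Measure.map_apply (by fun_prop) measurableSet_Icc]
  refine h.trans (measure_mono fun u hu => ?_)
  have hy0 := norm_nonneg y
  rw [le_div_iff₀ ht] at hy
  obtain ⟨h1, h2⟩ := hu
  obtain ⟨ha1, ha2⟩ := ha
  have hc0 : 0 ≤ ‖y‖ * t / 2 := by positivity
  have hc1 : ‖y‖ * t / 2 ≤ 1 := by linarith
  constructor
  · calc -1 - a ≤ (‖y‖ * t / 2) * (-1 - a) := by nlinarith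
      _ = ‖y‖ * (-((1 + a) * t / 2)) := by ring
      _ ≤ ‖y‖ * u := by gcongr
  · calc ‖y‖ * u ≤ ‖y‖ * ((1 - a) * t / 2) := by gcongr
      _ = (‖y‖ * t / 2) * (1 - a) := by ring
      _ ≤ 1 - a := by nlinarith

/-! ### From the random rows to the success event -/

/-- The rows of a Gaussian matrix are independent standard Gaussian vectors. -/
theorem IsGaussianMatrix.map_rows {Ω : Type*} [MeasurableSpace Ω] {P : Measure Ω}
    [IsProbabilityMeasure P] {D d : ℕ} {A : Ω → Matrix (Fin D) (Fin d) ℝ}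
    (hA : IsGaussianMatrix P A) :
    AEMeasurable (fun ω i => WithLp.toLp 2 (A ω i) : Ω → Fin D → EuclideanSpace ℝ (Fin d)) P ∧
      P.map (fun ω i => WithLp.toLp 2 (A ω i) : Ω → Fin D → EuclideanSpace ℝ (Fin d)) =
      Measure.pi fun _ => stdGaussian (EuclideanSpace ℝ (Fin d)) := by
  have hmeas : ∀ ij : Fin D × Fin d, AEMeasurable (fun ω => A ω ij.1 ij.2) P := fun ij =>
    (hA.hasLaw ij.1 ij.2).aemeasurable
  have hflat := hA.indep.map_fun_eq_pi_map hmeas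
  simp only [(hA.hasLaw _ _).map_eq] at hflat
  have hflatm : AEMeasurable (fun ω (ij : Fin D × Fin d) => A ω ij.1 ij.2) P :=
    aemeasurable_pi_lambda _ hmeas
  have hrow : AEMeasurable
      (fun ω i => WithLp.toLp 2 (A ω i) : Ω → Fin D → EuclideanSpace ℝ (Fin d)) P :=
    aemeasurable_pi_lambda _ fun i =>
      (MeasurableEquiv.toLp 2 (Fin d → ℝ)).measurable.comp_aemeasurable
      (aemeasurable_pi_lambda _ fun j => hmeas (i, j))
  refine ⟨hrow, ?_⟩
  have := Measure.isProbabilityMeasure_map hrow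
  rw [← charFun_eq_pi_iff]
  intro t
  have h1 := charFun_pi (μ := fun _ : Fin D × Fin d => gaussianReal 0 1)
    (WithLp.toLp 2 fun ij => t ij.1 ij.2)
  have htoLp : Measurable (WithLp.toLp 2 : (Fin D × Fin d → ℝ) →
      PiLp 2 fun _ : Fin D × Fin d => ℝ) :=
    (MeasurableEquiv.toLp 2 _).measurable
  have htoLp' : Measurable (WithLp.toLp 2 : (Fin D → EuclideanSpace ℝ (Fin d)) →
      PiLp 2 fun _ : Fin D => EuclideanSpace ℝ (Fin d)) :=
    (MeasurableEquiv.toLp 2 _).measurable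
  rw [← hflat, charFun_apply, integral_map htoLp.aemeasurable (by fun_prop),
    integral_map hflatm (by fun_prop)] at h1
  rw [charFun_apply, integral_map htoLp'.aemeasurable (by fun_prop),
    integral_map hrow (by fun_prop)]
  simp only [PiLp.inner_apply, Fintype.sum_prod_type] at h1 ⊢
  rw [h1, Fintype.prod_prod_type]
  refine Finset.prod_congr rfl fun i _ => ?_
  simp only [charFun_gaussianReal, charFun_stdGaussian]
  rw [← Complex.exp_sum]
  congr 1
  simp only [EuclideanSpace.norm_sq_eq, Real.norm_eq_abs, sq_abs, ← Complex.ofReal_pow]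
  push_cast
  rw [← Finset.sum_neg_distrib, Finset.sum_div]
  exact Finset.sum_congr rfl fun j _ => by simp; ring

/-- The row systems `b` for which some `y` with `‖y‖ ≤ ρ` makes the point with coordinates
`⟪b i, y⟫ + p i` feasible and equal to `x` in the coordinates selected by `q`. -/
def feasibleHitSet {D d : ℕ} (q : Fin D → Prop) (x p : EuclideanSpace ℝ (Fin D)) (ρ : ℝ) :
    Set (Fin D → EuclideanSpace ℝ (Fin d)) :=
  {b | ∃ y ∈ Metric.closedBall (0 : EuclideanSpace ℝ (Fin d)) ρ,
    (∀ i, q i → inner ℝ (b i) y + p i = x i) ∧ ∀ i, inner ℝ (b i) y + p i ∈ Set.Icc (-1 : ℝ) 1}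

theorem measurableSet_feasibleHitSet {D d : ℕ} (q : Fin D → Prop) (x p : EuclideanSpace ℝ (Fin D))
    (ρ : ℝ) : MeasurableSet (feasibleHitSet (d := d) q x p ρ) := by
  refine (isClosed_setOf_exists_mem_of_isCompact (isCompact_closedBall _ _) ?_).measurableSet
  rw [Set.ofPred_and]
  simp only [Set.ofPred_forall]
  refine IsClosed.inter (isClosed_iInter fun i => isClosed_iInter fun _ =>
    isClosed_eq (by fun_prop) (by fun_prop)) (isClosed_iInter fun i => ?_)
  exact isClosed_Icc.preimage (f := fun q : (Fin D → EuclideanSpace ℝ (Fin d)) ×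
    EuclideanSpace ℝ (Fin d) => inner ℝ (q.1 i) q.2 + p i) (by fun_prop)

/-- The selected rows produce a short `y` that hits the target `x`; it depends on them alone, so
given `y` each of the other `D - m` coordinates is independently feasible. The target differs from
`p` by a vector of norm at most `2 √m`. -/
theorem le_pi_stdGaussian_feasibleHitSet {D d k m : ℕ} (q : Fin D → Prop) [DecidablePred q]
    (hqm : Fintype.card {i // q i} = m) (hm : 0 < m)
    (hk : k + m ≤ d + 1) {x p : EuclideanSpace ℝ (Fin D)} (hx : x ∈ feasibleBox D)
    (hp : p ∈ feasibleBox D) {t : ℝ} (ht : 0 < t) :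
    ENNReal.ofReal (1 / 2 - gaussianPDFReal 0 1 t / t) ^ (D - m) *
        stdGaussian (EuclideanSpace ℝ (Fin k)) {v | √m * t ≤ ‖v‖} ≤
      (Measure.pi fun _ : Fin D => stdGaussian (EuclideanSpace ℝ (Fin d)))
        (feasibleHitSet q x p (2 / t)) := by
  have hG := measurableSet_feasibleHitSet (d := d) q x p (2 / t)
  have hmp := measurePreserving_piEquivPiSubtypeProd
    (fun _ : Fin D => stdGaussian (EuclideanSpace ℝ (Fin d))) q
  set e := MeasurableEquiv.piEquivPiSubtypeProd (fun _ : Fin D => EuclideanSpace ℝ (Fin d)) q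
  rw [← hmp.symm.measure_preimage hG.nullMeasurableSet]
  set z : EuclideanSpace ℝ {i // q i} := WithLp.toLp 2 fun i => x i - p i
  have hz : ‖z‖ / (2 / t) ≤ √m * t := by
    have h1 : ‖z‖ ≤ 2 * √m := by
      rw [EuclideanSpace.norm_eq]
      refine Real.sqrt_le_iff.mpr ⟨by positivity, ?_⟩
      rw [mul_pow, Real.sq_sqrt (by positivity)]
      calc ∑ i, ‖z i‖ ^ 2 ≤ ∑ _i : {i // q i}, (2 : ℝ) ^ 2 := by
            refine Finset.sum_le_sum fun i _ => ?_
            have hxi := hx i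
            have hpi := hp i
            have : ‖z i‖ ≤ 2 := by
              rw [Real.norm_eq_abs, abs_le]
              simp only [z]
              constructor <;> linarith [hxi.1, hxi.2, hpi.1, hpi.2]
            gcongr
        _ = 2 ^ 2 * (m : ℝ) := by simp [hqm]; ring
    rw [div_div_eq_mul_div, div_le_iff₀ two_pos]
    nlinarith
  have : Nonempty {i // q i} := Fintype.card_pos_iff.mp (hqm ▸ hm)
  have hB := pi_stdGaussian_exists_ge (E := EuclideanSpace ℝ (Fin d)) (ι := {i // q i}) k
    (by simpa [hqm] using hk) z (ρ := 2 / t) (by positivity)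
  refine le_trans (mul_le_mul_right ((measure_mono fun v hv => hz.trans hv).trans hB) _)
    (prod_ge_of_forall_fiber _ _ (e.symm.measurable hG) _ _ ?_)
  rintro b ⟨y, hy, hby⟩
  have hyn : ‖y‖ ≤ 2 / t := by simpa using hy
  have hcard : Fintype.card {i // ¬ q i} = D - m := by
    simp [Fintype.card_subtype_compl, hqm]
  calc ENNReal.ofReal (1 / 2 - gaussianPDFReal 0 1 t / t) ^ (D - m)
      = ∏ _i : {i // ¬ q i}, ENNReal.ofReal (1 / 2 - gaussianPDFReal 0 1 t / t) := by
        rw [Finset.prod_const, Finset.card_univ, hcard]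
    _ ≤ ∏ i : {i // ¬ q i}, stdGaussian (EuclideanSpace ℝ (Fin d))
          {c | inner ℝ c y + p i ∈ Set.Icc (-1 : ℝ) 1} :=
        Finset.prod_le_prod' fun i _ => le_stdGaussian_inner_add_mem_Icc ht hyn (hp i)
    _ = (Measure.pi fun _ : {i // ¬ q i} => stdGaussian (EuclideanSpace ℝ (Fin d)))
          (Set.univ.pi fun i => {c | inner ℝ c y + p i ∈ Set.Icc (-1 : ℝ) 1}) := by
        rw [Measure.pi_pi]
    _ ≤ _ := by
        refine measure_mono fun c hc => ?_
        have hin : ∀ i (hi : q i), e.symm (b, c) i = b ⟨i, hi⟩ := fun i hi => by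
          simp [e, MeasurableEquiv.piEquivPiSubtypeProd, hi]
        have hout : ∀ i (hi : ¬ q i), e.symm (b, c) i = c ⟨i, hi⟩ := fun i hi => by
          simp [e, MeasurableEquiv.piEquivPiSubtypeProd, hi]
        have hSx : ∀ i, q i → inner ℝ (e.symm (b, c) i) y + p i = x i := fun i hi => by
          rw [hin i hi, hby ⟨i, hi⟩]
          simp [z]
        refine ⟨y, hy, hSx, fun i => ?_⟩
        by_cases hi : q i
        · rw [hSx i hi]
          exact hx i
        · rw [hout i hi]
          exact hc ⟨i, hi⟩ (Set.mem_univ _)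

theorem isCompact_feasibleBox (D : ℕ) : IsCompact (feasibleBox D) := by
  have h : IsCompact (Set.univ.pi fun _ : Fin D => Set.Icc (-1 : ℝ) 1) :=
    isCompact_univ_pi fun _ => isCompact_Icc
  convert h.image (PiLp.continuous_toLp 2 fun _ : Fin D => ℝ) using 1
  ext x
  constructor
  · exact fun hx => ⟨x.ofLp, fun i _ => hx i, rfl⟩
  · rintro ⟨x, hx, rfl⟩
    exact fun i => hx i (Set.mem_univ _)

theorem exists_mem_feasibleBox_eq_optimalValue {D : ℕ} {f : EuclideanSpace ℝ (Fin D) → ℝ}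
    (hf : Continuous f) : ∃ x ∈ feasibleBox D, f x = optimalValue f := by
  obtain ⟨x, hx, h⟩ := (isCompact_feasibleBox D).exists_sInf_image_eq
    ⟨0, fun i => by simp⟩ hf.continuousOn
  exact ⟨x, hx, h.symm⟩

theorem finrank_coordinateSubspace {D : ℕ} (S : Finset (Fin D)) :
    Module.finrank ℝ (coordinateSubspace S) = S.card := by
  have h : LinearIndependent ℝ fun i : S => EuclideanSpace.single (i : Fin D) (1 : ℝ) := by
    have := (EuclideanSpace.basisFun (Fin D) ℝ).toBasis.linearIndependent.comp
      (fun i : S => (i : Fin D)) Subtype.val_injective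
    simpa [Function.comp_def] using this
  have h2 := finrank_span_eq_card h
  rw [coordinateSubspace, Set.image_eq_range]
  simpa using h2

/-- A function depending only on the projection to a coordinate subspace is determined by the
selected coordinates. -/
theorem DependsOnlyOnProjection.congr {D : ℕ} {f : EuclideanSpace ℝ (Fin D) → ℝ}
    {S : Finset (Fin D)} (hf : DependsOnlyOnProjection f (coordinateSubspace S))
    {x x' : EuclideanSpace ℝ (Fin D)} (h : ∀ i ∈ S, x i = x' i) : f x = f x' := by
  have key : ∀ x : EuclideanSpace ℝ (Fin D),
      f x = f (∑ i ∈ S, x i • EuclideanSpace.single i (1 : ℝ)) := by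
    intro x
    set w := ∑ i ∈ S, x i • EuclideanSpace.single i (1 : ℝ) with hw
    have hwi : ∀ j ∈ S, w j = x j := fun j hj => by
      simp [hw, Pi.single_apply, hj]
    have hwS : w ∈ coordinateSubspace S :=
      Submodule.sum_mem _ fun i hi => Submodule.smul_mem _ _
        (Submodule.subset_span ⟨i, hi, rfl⟩)
    have hz : x - w ∈ (coordinateSubspace S)ᗮ := by
      rw [coordinateSubspace, Submodule.mem_orthogonal]
      intro u hu
      induction hu using Submodule.span_induction with
      | mem u hu =>
        obtain ⟨i, hi, rfl⟩ := hu
        rw [EuclideanSpace.inner_single_left, PiLp.sub_apply, hwi i hi]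
        simp
      | zero => simp
      | add u v _ _ hu hv => rw [inner_add_left, hu, hv, add_zero]
      | smul a u _ hu => rw [inner_smul_left, hu, mul_zero]
    rw [← hf w hwS _ hz, add_sub_cancel]
  rw [key x, key x']
  congr 1
  exact Finset.sum_congr rfl fun i hi => by rw [h i hi]

/-- The set on the right need not be measurable; its outer measure dominates the measure of the
measurable event `feasibleHitSet` for a minimiser `x` of `f` on the box. -/
theorem IsGaussianMatrix.le_measure_successful {Ω : Type*} [MeasurableSpace Ω] {P : Measure Ω}
    [IsProbabilityMeasure P] {D d k : ℕ} {A : Ω → Matrix (Fin D) (Fin d) ℝ}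
    (hA : IsGaussianMatrix P A) {f : EuclideanSpace ℝ (Fin D) → ℝ} (hf : Continuous f)
    {S : Finset (Fin D)} (hS : S.Nonempty)
    (hfS : DependsOnlyOnProjection f (coordinateSubspace S))
    (hk : k + S.card ≤ d + 1) {p : EuclideanSpace ℝ (Fin D)}
    (hp : p ∈ feasibleBox D) {t : ℝ} (ht : 0 < t) :
    ENNReal.ofReal (1 / 2 - gaussianPDFReal 0 1 t / t) ^ (D - S.card) *
        stdGaussian (EuclideanSpace ℝ (Fin k)) {v | √S.card * t ≤ ‖v‖} ≤
      P {ω | ReducedProblemSuccessful f p (A ω)} := by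
  obtain ⟨x, hx, hfx⟩ := exists_mem_feasibleBox_eq_optimalValue hf
  obtain ⟨hrow, hlaw⟩ := hA.map_rows
  refine (le_pi_stdGaussian_feasibleHitSet (· ∈ S) (by simp) hS.card_pos hk hx hp ht).trans ?_
  rw [← hlaw, Measure.map_apply_of_aemeasurable hrow (measurableSet_feasibleHitSet _ _ _ _)]
  refine measure_mono ?_
  rintro ω ⟨y, -, hS, hbox⟩
  have hval : ∀ i, (WithLp.toLp 2 (A ω *ᵥ y.ofLp) + p) i =
      inner ℝ (WithLp.toLp 2 (A ω i) : EuclideanSpace ℝ (Fin d)) y + p i := fun i => by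
    simp [Matrix.mulVec, dotProduct, PiLp.inner_apply, mul_comm]
  refine ⟨y.ofLp, ?_, fun i => ?_⟩
  · rw [← hfx]
    exact hfS.congr fun i hi => (hval i).trans (hS i hi)
  · rw [hval i]
    exact hbox i

/-! ### The threshold and the rate -/

/-- The value `t = √(2 L - log L)`, `L = log (n + 1)`, balances the two factors of the
probability: it is of order `√L`, and `exp (-t ^ 2 / 2) = √L / (n + 1)`. -/
theorem exists_gaussian_threshold (n : ℕ) (hn : 1 ≤ n) : ∃ t : ℝ, 1 ≤ t ∧
    √(Real.log (n + 1)) ≤ t ∧ t ≤ √5 * √(Real.log (n + 1)) ∧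
      Real.exp (-t ^ 2 / 2) = √(Real.log (n + 1)) / (n + 1) := by
  set L := Real.log (n + 1)
  have hn1 : (1 : ℝ) ≤ n := by exact_mod_cast hn
  -- For `n = 1` one has `L < 1` and `log L < 0`, so `L` must be kept away from `0`.
  have hL : 0.69 < L := by
    have h1 : Real.log 2 ≤ L := Real.log_le_log two_pos (by linarith)
    linarith [Real.log_two_gt_d9]
  have hL0 : 0 < L := by linarith
  have hup : Real.log L ≤ L - 1 := Real.log_le_sub_one_of_pos hL0
  have hlow : -Real.log L ≤ 3 * L := by
    have h1 := Real.log_le_sub_one_of_pos (inv_pos.mpr hL0)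
    rw [Real.log_inv] at h1
    have h2 : L⁻¹ ≤ 1 + 3 * L := by
      rw [inv_le_iff_one_le_mul₀ hL0]
      nlinarith
    linarith
  have hnn : 0 ≤ 2 * L - Real.log L := by linarith
  refine ⟨√(2 * L - Real.log L), Real.one_le_sqrt.mpr (by linarith),
    Real.sqrt_le_sqrt (by linarith), ?_, ?_⟩
  · rw [← Real.sqrt_mul (by norm_num)]
    exact Real.sqrt_le_sqrt (by linarith)
  · rw [Real.sq_sqrt hnn, show -(2 * L - Real.log L) / 2 = Real.log L / 2 - L by ring, Real.exp_sub,
      Real.exp_log (by linarith), Real.sqrt_eq_rpow, Real.rpow_def_of_pos hL0]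
    congr 2
    ring

/-- At the threshold the probability that `n` coordinates stay feasible is at least `2 ^ (-n) / 5`:
`φ(t) / t ≤ (2 / 5) / (n + 1)` because `1 / √(2 π) ≤ 2 / 5`, and Bernoulli's inequality applies. -/
theorem le_half_sub_pow (n : ℕ) {s t : ℝ} (ht : 0 < t) (hst : s ≤ t)
    (hexp : Real.exp (-t ^ 2 / 2) = s / (n + 1)) :
    0 ≤ 1 / 2 - gaussianPDFReal 0 1 t / t ∧
      1 / 5 * (1 / 2) ^ n ≤ (1 / 2 - gaussianPDFReal 0 1 t / t) ^ n := by
  have hn : (0 : ℝ) < n + 1 := by positivity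
  have hsqrt : 5 / 2 ≤ √(2 * Real.pi) := by
    apply Real.le_sqrt_of_sq_le
    nlinarith [Real.pi_gt_d2]
  have hφ : gaussianPDFReal 0 1 t / t ≤ 2 / 5 / (n + 1) := by
    rw [gaussianPDFReal_zero_one]
    simp only [hexp]
    have h1 : (√(2 * Real.pi))⁻¹ ≤ 2 / 5 := by
      rw [inv_le_comm₀ (by positivity) (by norm_num)]
      rwa [inv_div]
    calc (√(2 * Real.pi))⁻¹ * (s / (n + 1)) / t
        = (√(2 * Real.pi))⁻¹ * (s / t) / (n + 1) := by ring
      _ ≤ 2 / 5 * 1 / (n + 1) := by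
          have h2 : s / t ≤ 1 := (div_le_one ht).mpr hst
          have h3 : 0 ≤ s / t := by
            have : 0 ≤ s / (n + 1) := hexp ▸ (Real.exp_pos _).le
            have : 0 ≤ s := by
              have := mul_nonneg this hn.le
              rwa [div_mul_cancel₀ _ hn.ne'] at this
            positivity
          gcongr
      _ = 2 / 5 / (n + 1) := by ring
  have hle : 2 / 5 / ((n : ℝ) + 1) ≤ 2 / 5 :=
    div_le_self (by norm_num) (by linarith [n.cast_nonneg (α := ℝ)])
  have hb : 1 / 2 * (1 + -(4 / 5 / ((n : ℝ) + 1))) ≤ 1 / 2 - gaussianPDFReal 0 1 t / t := by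
    have : 1 / 2 * (1 + -(4 / 5 / ((n : ℝ) + 1))) = 1 / 2 - 2 / 5 / (n + 1) := by ring
    linarith
  have hle' : 4 / 5 / ((n : ℝ) + 1) ≤ 4 / 5 := by
    have : 4 / 5 / ((n : ℝ) + 1) = 2 * (2 / 5 / (n + 1)) := by ring
    linarith
  refine ⟨by linarith, ?_⟩
  have hbern := one_add_mul_le_pow (a := -(4 / 5 / ((n : ℝ) + 1))) (by linarith) n
  have hfrac : (n : ℝ) * (4 / 5 / (n + 1)) ≤ 4 / 5 := by
    rw [mul_div_assoc', div_le_iff₀ hn]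
    linarith
  calc 1 / 5 * (1 / 2) ^ n ≤ (1 + -(4 / 5 / ((n : ℝ) + 1))) ^ n * (1 / 2) ^ n := by
        gcongr
        linarith
    _ = (1 / 2 * (1 + -(4 / 5 / ((n : ℝ) + 1)))) ^ n := by rw [mul_pow, mul_comm]
    _ ≤ _ := by
        gcongr
        have : 0 ≤ 1 + -(4 / 5 / ((n : ℝ) + 1)) := by linarith
        positivity

/-- The chi tail at `√m t` in terms of `L`. The exponent `k - 2` can be `-1`, so the comparison of
`√m t` with `√L` is needed in both directions; `w` is their ratio. -/
theorem le_rpow_mul_exp {L N t : ℝ} (hL : 0 < L) {d m k : ℕ} (hm : 1 ≤ m)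
    (hk : k + m = d + 1) (hk1 : 1 ≤ k) (h1 : √L ≤ t) (h2 : t ≤ √5 * √L)
    (hexp : Real.exp (-t ^ 2 / 2) = √L / N) :
    (√(5 * m))⁻¹ * (L ^ (((d : ℝ) - 1) / 2) / N ^ m) ≤
      (√m * t) ^ ((k : ℝ) - 2) * Real.exp (-(√m * t) ^ 2 / 2) := by
  have hsL : 0 < √L := Real.sqrt_pos.mpr hL
  have ht : 0 < t := hsL.trans_le h1
  have hm1 : (1 : ℝ) ≤ m := by exact_mod_cast hm
  have hsm : 1 ≤ √(m : ℝ) := Real.one_le_sqrt.mpr hm1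
  have hN : 0 < N := by
    have : 0 < √L / N := hexp ▸ Real.exp_pos _
    exact (div_pos_iff_of_pos_left hsL).mp this
  have hE : Real.exp (-(√m * t) ^ 2 / 2) = √L ^ m / N ^ m := by
    rw [← div_pow, ← hexp, ← Real.exp_nat_mul, mul_pow, Real.sq_sqrt (by positivity)]
    congr 1
    ring
  set w := √m * t / √L with hw
  have hw1 : 1 ≤ w := by
    rw [hw, le_div_iff₀ hsL]
    nlinarith
  have hw2 : w ≤ √(5 * m) := by
    rw [hw, div_le_iff₀ hsL, Real.sqrt_mul (by norm_num)]
    calc √m * t ≤ √m * (√5 * √L) := by gcongr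
      _ = √5 * √m * √L := by ring
  have hx : √m * t = √L * w := by rw [hw]; field_simp
  have hk1' : (1 : ℝ) ≤ k := by exact_mod_cast hk1
  have hwpow : (√(5 * m))⁻¹ ≤ w ^ ((k : ℝ) - 2) :=
    calc (√(5 * m))⁻¹ ≤ w⁻¹ := by gcongr
      _ = w ^ (-1 : ℝ) := (Real.rpow_neg_one w).symm
      _ ≤ w ^ ((k : ℝ) - 2) := Real.rpow_le_rpow_of_exponent_le hw1 (by linarith)
  have hLpow : L ^ (((d : ℝ) - 1) / 2) = √L ^ ((k : ℝ) - 2) * √L ^ m := by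
    rw [← Real.rpow_natCast (√L) m, ← Real.rpow_add hsL, Real.sqrt_eq_rpow, ← Real.rpow_mul hL.le]
    congr 1
    have : (k : ℝ) + m = d + 1 := by exact_mod_cast hk
    linarith
  rw [hE, hx, Real.mul_rpow hsL.le (by positivity), hLpow]
  calc (√(5 * m))⁻¹ * (√L ^ ((k : ℝ) - 2) * √L ^ m / N ^ m)
      ≤ w ^ ((k : ℝ) - 2) * (√L ^ ((k : ℝ) - 2) * √L ^ m / N ^ m) := by gcongr
    _ = _ := by ring

/-- In effective dimension `0` the success probability is `1`, and the rate only has to be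
bounded. -/
theorem exists_log_rpow_div_two_pow_le (a : ℝ) :
    ∃ C : ℝ, 0 < C ∧ ∀ n : ℕ, Real.log (n + 1) ^ a / 2 ^ n ≤ C := by
  have h := (isLittleO_log_rpow_rpow_atTop a one_pos).tendsto_div_nhds_zero
  have h1 : Tendsto (fun n : ℕ => (n : ℝ) + 1) atTop atTop :=
    tendsto_atTop_add_const_right _ _ tendsto_natCast_atTop_atTop
  obtain ⟨C, hC⟩ := (h.comp h1).bddAbove_range
  refine ⟨max C 1, by positivity, fun n => ?_⟩
  refine le_trans ?_ ((hC ⟨n, rfl⟩).trans (le_max_left _ _))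
  simp only [Function.comp_apply, Real.rpow_one]
  have h2 : (n : ℝ) + 1 ≤ 2 ^ n := by exact_mod_cast Nat.lt_two_pow_self
  have h3 : 0 ≤ Real.log ((n : ℝ) + 1) := Real.log_nonneg (by linarith [n.cast_nonneg (α := ℝ)])
  gcongr

theorem ReducedProblemSuccessful.of_finset_empty {D d : ℕ} {f : EuclideanSpace ℝ (Fin D) → ℝ}
    (hf : Continuous f) (hfS : DependsOnlyOnProjection f (coordinateSubspace ∅))
    {p : EuclideanSpace ℝ (Fin D)} (hp : p ∈ feasibleBox D) (A : Matrix (Fin D) (Fin d) ℝ) :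
    ReducedProblemSuccessful f p A := by
  obtain ⟨x, -, hfx⟩ := exists_mem_feasibleBox_eq_optimalValue hf
  refine ⟨0, ?_, by simpa using hp⟩
  rw [← hfx]
  exact hfS.congr (by simp)

/-- The rate `(log (n + 1)) ^ ((d - 1) / 2) / (2 ^ n * (n + 1) ^ m)`, where `m` is the effective
dimension and `n` the number of remaining coordinates. -/
noncomputable def successRate (m d n : ℕ) : ℝ :=
  Real.log ((n : ℝ) + 1) ^ (((d : ℝ) - 1) / 2) / (2 ^ n * ((n : ℝ) + 1) ^ m)

theorem successRate_pos (m d : ℕ) {n : ℕ} (hn : 1 ≤ n) : 0 < successRate m d n := by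
  have hn1 : (1 : ℝ) ≤ n := by exact_mod_cast hn
  have : 0 < Real.log ((n : ℝ) + 1) := Real.log_pos (by linarith)
  rw [successRate]
  positivity

/-- One constant serves all dimensions, objective functions, shifts and probability spaces. -/
theorem exists_mul_successRate_le (d_e d : ℕ) (hd : d_e ≤ d) :
    ∃ c : ℝ, 0 < c ∧ ∀ n : ℕ, 1 ≤ n →
      ∀ (f : EuclideanSpace ℝ (Fin (d_e + n)) → ℝ) (S : Finset (Fin (d_e + n))),
        Continuous f →
        HasEffectiveSubspace f d_e (coordinateSubspace S) →
        ∀ (Ω : Type*) [MeasurableSpace Ω] (P : Measure Ω) [IsProbabilityMeasure P]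
          (A : Ω → Matrix (Fin (d_e + n)) (Fin d) ℝ),
          IsGaussianMatrix P A →
          ∀ p ∈ feasibleBox (d_e + n),
            c * successRate d_e d n ≤ P.real {ω | ReducedProblemSuccessful f p (A ω)} := by
  rcases Nat.eq_zero_or_pos d_e with h0 | hm
  · obtain ⟨C, hC, hle⟩ := exists_log_rpow_div_two_pow_le (((d : ℝ) - 1) / 2)
    refine ⟨C⁻¹, inv_pos.mpr hC, fun n hn f S hf hS Ω _ P _ A hA p hp => ?_⟩
    have hS0 : S = ∅ := by
      rw [← Finset.card_eq_zero, ← finrank_coordinateSubspace, hS.finrank_eq, h0]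
    subst hS0
    have huniv : {ω | ReducedProblemSuccessful f p (A ω)} = Set.univ :=
      Set.eq_univ_of_forall fun ω => .of_finset_empty hf hS.dependsOnly hp (A ω)
    rw [huniv, probReal_univ, successRate, h0, pow_zero, mul_one, inv_mul_le_iff₀ hC, mul_one]
    exact hle n
  · obtain ⟨c, hc, htail⟩ := exists_le_stdGaussian_norm_ge (d - d_e + 1) (by omega)
    refine ⟨1 / 5 * (√(5 * d_e))⁻¹ * c, by positivity, fun n hn f S hf hS Ω _ P _ A hA p hp => ?_⟩
    obtain ⟨t, ht1, hLt, htL, hexp⟩ := exists_gaussian_threshold n hn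
    have hn1 : (1 : ℝ) ≤ n := by exact_mod_cast hn
    have hL : 0 < Real.log ((n : ℝ) + 1) := Real.log_pos (by linarith)
    have hcard : S.card = d_e := by rw [← finrank_coordinateSubspace, hS.finrank_eq]
    have ht : 0 < t := by linarith
    have hprob := hA.le_measure_successful (k := d - d_e + 1) hf (Finset.card_pos.mp (by omega))
      hS.dependsOnly (by omega) hp ht
    rw [hcard, Nat.add_sub_cancel_left] at hprob
    have hm1 : (1 : ℝ) ≤ d_e := by exact_mod_cast hm
    have hx : 1 ≤ √d_e * t := one_le_mul_of_one_le_of_one_le (Real.one_le_sqrt.mpr hm1) ht1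
    obtain ⟨hb0, hb⟩ := le_half_sub_pow n ht hLt hexp
    have hscal := le_rpow_mul_exp hL (d := d) hm (by omega : d - d_e + 1 + d_e = d + 1) (by omega)
      hLt htL hexp
    rw [Measure.real, ← ENNReal.ofReal_le_iff_le_toReal (by finiteness)]
    refine le_trans ?_ ((mul_le_mul_right (htail _ hx) _).trans hprob)
    rw [← ENNReal.ofReal_pow hb0, ← ENNReal.ofReal_mul (by positivity), successRate]
    apply ENNReal.ofReal_le_ofReal
    calc _ = (1 / 5 * (1 / 2) ^ n) * (c * ((√(5 * d_e))⁻¹ *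
          (Real.log ((n : ℝ) + 1) ^ (((d : ℝ) - 1) / 2) / ((n : ℝ) + 1) ^ d_e))) := by
          rw [one_div_pow]
          field_simp
      _ ≤ _ := by gcongr

theorem theorem3p8 (d_e d : ℕ) (hd : d_e ≤ d) :
    ∃ τ : ℕ → ℝ,
      (τ =Θ[atTop] fun D : ℕ =>
        Real.log ((D : ℝ) - d_e + 1) ^ (((d : ℝ) - 1) / 2) /
          ((2 : ℝ) ^ ((D : ℝ) - d_e) * ((D : ℝ) - d_e + 1) ^ d_e)) ∧
      ∀ D : ℕ, d_e < D → 0 < τ D ∧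
        ∀ (f : EuclideanSpace ℝ (Fin D) → ℝ) (S : Finset (Fin D)),
          Continuous f →
          HasEffectiveSubspace f d_e (coordinateSubspace S) →
          ∀ (Ω : Type*) [MeasurableSpace Ω] (P : Measure Ω) [IsProbabilityMeasure P]
            (A : Ω → Matrix (Fin D) (Fin d) ℝ),
            IsGaussianMatrix P A →
            ∀ p ∈ feasibleBox D,
              τ D ≤ P.real {ω | ReducedProblemSuccessful f p (A ω)} := by
  obtain ⟨c, hc, h⟩ := exists_mul_successRate_le d_e d hd
  set g : ℕ → ℝ := fun D : ℕ => Real.log ((D : ℝ) - d_e + 1) ^ (((d : ℝ) - 1) / 2) /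
          ((2 : ℝ) ^ ((D : ℝ) - d_e) * ((D : ℝ) - d_e + 1) ^ d_e)
  have hg : ∀ n : ℕ, g (d_e + n) = successRate d_e d n := fun n => by
    simp [g, successRate]
  refine ⟨fun D => c * g D, (isTheta_refl g atTop).const_mul_left hc.ne', fun D hD => ?_⟩
  obtain ⟨n, rfl⟩ := Nat.exists_eq_add_of_le hD.le
  have hn : 1 ≤ n := by omega
  simp only [hg]
  exact ⟨mul_pos hc (successRate_pos d_e d hn), h n hn⟩
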